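/- Let $N\ge 3$ be an integer, and let $T^2_N$ be the discrete torus, i.e. the Cayley graph of $\mathbb Z/N\mathbb Z\times\mathbb Z/N\mathbb Z$ with generating set $\{(0,1),(0,-1),(1,0),(-1,0)\}$. For $k_1,k_2\in\mathbb Z/N\mathbb Z$ put $$\mu(k_1,k_2)=2\cos\frac{2k_1\pi}{N}+2\cos\frac{2k_2\pi}{N},$$ and let $m(k_1,k_2)$ be the multiplicity of $\mu(k_1,k_2)$ as an eigenvalue of the adjacency matrix of $T^2_N$. (i) If $N$ is odd, then - $m(0,0)=1$; - $m(0,k)=m(k,k)=m(k,-k)=4$ for all $k\in\mathbb Z/N\mathbb Z\setminus\{0\}$; - $m(k_1,k_2)=8$ for all $k_1,k_2\in\mathbb Z/N\mathbb Z\setminus\{0\}$ with $k_1\ne\pm k_2$. (ii) If $N$ is even, $12\nmid N$, $30\nmid N$ and $42\nmid N$, then - $\mu(0,N/2)=0$ and $m(0,N/2)=2N-2$, and more generally $m(k_1,k_2)=2N-2$ whenever $\mu(k_1,k_2)=0$; - $m(0,0)=m(N/2,N/2)=1$; - $m(0,k)=m(N/2,k)=4$ for all $k\in\mathbb Z/N\mathbb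 Z\setminus\{0,N/2\}$, and $m(k,k)=m(k,-k)=4$ for all such $k$ with $\mu(k,k)\neq 0$; - $m(k_1,k_2)=8$ for all $k_1,k_2\in\mathbb Z/N\mathbb Z\setminus\{0,N/2\}$ with $k_1\ne\pm k_2$ and $\mu(k_1,k_2)\ne 0$. -/

import Mathlib

noncomputable section

namespace DiscreteTorus

/-- The generating set `{(0, 1), (0, -1), (1, 0), (-1, 0)}` of `ℤ/N × ℤ/N`. -/
def genSet (N : ℕ) : Set (ZMod N × ZMod N) :=
  {(0, 1), (0, -1), (1, 0), (-1, 0)}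

/-- The discrete torus `T²_N`: the Cayley graph of `ℤ/N × ℤ/N` with respect to `genSet N`. -/
def torus (N : ℕ) : SimpleGraph (ZMod N × ZMod N) :=
  SimpleGraph.addCayley (genSet N)

open Classical in
/-- The adjacency matrix of `T²_N`, with real entries. -/
def adj (N : ℕ) : Matrix (ZMod N × ZMod N) (ZMod N × ZMod N) ℝ :=
  (torus N).adjMatrix ℝ

/-- The spectrum `σ(T²_N)`: the multiset of eigenvalues of the adjacency matrix, each repeated
according to its multiplicity as a root of the characteristic polynomial. (The matrix is real
symmetric, so that all roots are real, and algebraic and geometric multiplicities agree.) -/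
def spec (N : ℕ) [NeZero N] : Multiset ℝ :=
  (adj N).charpoly.roots

/-- `μ_N(k₁, k₂) = 2 cos (2 k₁ π / N) + 2 cos (2 k₂ π / N)`, computed with the representatives
of `k₁, k₂` in `{0, …, N - 1}`. -/
def mu (N : ℕ) (k₁ k₂ : ZMod N) : ℝ :=
  2 * Real.cos (2 * (k₁.val : ℝ) / (N : ℝ) * Real.pi) +
    2 * Real.cos (2 * (k₂.val : ℝ) / (N : ℝ) * Real.pi)

/-- `m(k₁, k₂)`: the multiplicity of `μ_N(k₁, k₂)` in the spectrum of `T²_N`. -/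
def mult (N : ℕ) [NeZero N] (k₁ k₂ : ZMod N) : ℕ :=
  (spec N).count (mu N k₁ k₂)

/-- The residue class of `N / 2` in `ℤ/N`; only used for even `N`. -/
def half (N : ℕ) : ZMod N := ((N / 2 : ℕ) : ZMod N)

end DiscreteTorus

end

/-! The characters of `ℤ/N × ℤ/N` diagonalize the adjacency matrix, so `m(a, b)` counts the pairs
`(c, d)` with `x + y = z + w`, where `x, y, z, w` are the values of `twoCos` at `a, b, c, d`. If
also `xy = zw`, then `{x, y} = {z, w}`; as `twoCos` determines its argument up to sign, counting is
then easy. The product comes from Galois conjugation: `ζ ↦ ζ ^ t` with `t` prime to `N` turns the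
relation into one between Chebyshev polynomials in `x, y, z, w`. For `N` odd, `t = 2` suffices; for
`3 ∤ N` and nonzero sum, `t = 3` does. If `6 ∣ N`, the hypotheses exclude 4, 5 and 7 as divisors,
and `t = 5, 7` together suffice. For even `N`, eigenvalue 0 is counted directly, since a shift by
`N/2` negates `twoCos`. -/

namespace DiscreteTorus

open ZMod (stdAddChar)

/-! ### Relations between sums of two cosines -/

section TwoCos

/-- `2 cos (2 π k / N)`. -/
noncomputable def twoCos {N : ℕ} (k : ZMod N) : ℝ :=
  2 * Real.cos (2 * (k.val : ℝ) / (N : ℝ) * Real.pi)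

theorem mu_eq {N : ℕ} (a b : ZMod N) : mu N a b = twoCos a + twoCos b := rfl

theorem eq_pair_of_sum_mul {x y z w : ℝ} (hs : x + y = z + w) (hp : x * y = z * w) :
    (x = z ∧ y = w) ∨ (x = w ∧ y = z) := by
  have : (x - z) * (x - w) = 0 := by linear_combination x * hs - hp
  rcases mul_eq_zero.1 this with h | h
  · exact Or.inl ⟨by linarith, by linarith⟩
  · exact Or.inr ⟨by linarith, by linarith⟩

variable {N : ℕ} [NeZero N]

theorem twoCos_eq (k : ZMod N) :
    (twoCos k : ℂ) = stdAddChar k + (stdAddChar k)⁻¹ := by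
  rw [ZMod.stdAddChar_apply, ZMod.toCircle_eq_circleExp, Circle.coe_exp, ← Complex.exp_neg, twoCos]
  push_cast
  rw [Complex.cos]
  ring_nf

theorem char_ne_zero (k : ZMod N) : (stdAddChar k : ℂ) ≠ 0 := by
  rw [ZMod.stdAddChar_apply]
  exact Circle.coe_ne_zero _

theorem twoCos_natCast_mul (t : ℕ) (k : ZMod N) :
    (twoCos ((t : ZMod N) * k) : ℂ) = stdAddChar k ^ t + (stdAddChar k)⁻¹ ^ t := by
  rw [twoCos_eq, ← nsmul_eq_mul, AddChar.map_nsmul_eq_pow, inv_pow]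

theorem twoCos_eq_iff {k l : ZMod N} : twoCos k = twoCos l ↔ k = l ∨ k = -l := by
  have h : twoCos k = twoCos l ↔ (twoCos k : ℂ) = twoCos l := by norm_cast
  have hk := char_ne_zero k
  have hl := char_ne_zero l
  rw [h, twoCos_eq, twoCos_eq, ← ZMod.injective_stdAddChar.eq_iff, ← ZMod.injective_stdAddChar.eq_iff,
    AddChar.map_neg_eq_inv]
  constructor
  · intro e
    have : ((stdAddChar k : ℂ) - stdAddChar l) * (stdAddChar k * stdAddChar l - 1) = 0 := by
      field_simp at e
      linear_combination e
    rcases mul_eq_zero.1 this with h | h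
    · exact Or.inl (sub_eq_zero.1 h)
    · exact Or.inr (eq_inv_of_mul_eq_one_left (sub_eq_zero.1 h))
  · rintro (h | h) <;> rw [h]
    rw [inv_inv, add_comm]

theorem twoCos_two_mul (k : ZMod N) : twoCos (((2 : ℕ) : ZMod N) * k) = twoCos k ^ 2 - 2 := by
  have hk := char_ne_zero k
  apply Complex.ofReal_injective
  rw [twoCos_natCast_mul]
  push_cast
  rw [twoCos_eq]
  field_simp
  ring

theorem twoCos_three_mul (k : ZMod N) :
    twoCos (((3 : ℕ) : ZMod N) * k) = twoCos k ^ 3 - 3 * twoCos k := by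
  have hk := char_ne_zero k
  apply Complex.ofReal_injective
  rw [twoCos_natCast_mul]
  push_cast
  rw [twoCos_eq]
  field_simp
  ring

theorem twoCos_five_mul (k : ZMod N) :
    twoCos (((5 : ℕ) : ZMod N) * k) = twoCos k ^ 5 - 5 * twoCos k ^ 3 + 5 * twoCos k := by
  have hk := char_ne_zero k
  apply Complex.ofReal_injective
  rw [twoCos_natCast_mul]
  push_cast
  rw [twoCos_eq]
  field_simp
  ring

theorem twoCos_seven_mul (k : ZMod N) :
    twoCos (((7 : ℕ) : ZMod N) * k) =
      twoCos k ^ 7 - 7 * twoCos k ^ 5 + 14 * twoCos k ^ 3 - 7 * twoCos k := by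
  have hk := char_ne_zero k
  apply Complex.ofReal_injective
  rw [twoCos_natCast_mul]
  push_cast
  rw [twoCos_eq]
  field_simp
  ring

theorem isPrimitiveRoot_char_one : IsPrimitiveRoot (stdAddChar (1 : ZMod N) : ℂ) N := by
  rw [IsPrimitiveRoot.iff_def]
  have key (l : ℕ) : (stdAddChar (1 : ZMod N) : ℂ) ^ l = stdAddChar (l : ZMod N) := by
    rw [← AddChar.map_nsmul_eq_pow, nsmul_one]
  refine ⟨by rw [key, ZMod.natCast_self, AddChar.map_zero_eq_one], fun l hl => ?_⟩
  rw [key, ← AddChar.map_zero_eq_one (stdAddChar (N := N)),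
    ZMod.injective_stdAddChar.eq_iff] at hl
  exact (ZMod.natCast_eq_zero_iff l N).1 hl

/-- Integral polynomial relations are preserved by the Galois conjugation `ζ ↦ ζ ^ t`. -/
theorem aeval_pow_eq_zero {ζ : ℂ} (hζ : IsPrimitiveRoot ζ N) {t : ℕ} (ht : t.Coprime N)
    {P : Polynomial ℤ} (hP : Polynomial.aeval ζ P = 0) : Polynomial.aeval (ζ ^ t) P = 0 := by
  have hdvd := minpoly.isIntegrallyClosed_dvd (hζ.isIntegral (NeZero.pos N)) hP
  rw [hζ.minpoly_eq_pow_coprime ht] at hdvd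
  exact Polynomial.aeval_eq_zero_of_dvd_aeval_eq_zero hdvd (minpoly.aeval ℤ _)

theorem twoCos_conj {t : ℕ} (ht : t.Coprime N) {a b c d : ZMod N}
    (h : twoCos a + twoCos b = twoCos c + twoCos d) :
    twoCos ((t : ZMod N) * a) + twoCos ((t : ZMod N) * b) =
      twoCos ((t : ZMod N) * c) + twoCos ((t : ZMod N) * d) := by
  -- The exponent `(-k).val` replaces a negative power, so that `twoCos k` is an integral polynomial
  -- in `ζ`.
  let q (k : ZMod N) : Polynomial ℤ := Polynomial.X ^ k.val + Polynomial.X ^ (-k).val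
  have hq (s : ℕ) (k : ZMod N) :
      Polynomial.aeval ((stdAddChar (1 : ZMod N) : ℂ) ^ s) (q k) = twoCos ((s : ZMod N) * k) := by
    have key (l : ZMod N) : ((stdAddChar (1 : ZMod N) : ℂ) ^ s) ^ l.val = stdAddChar ((s : ZMod N) * l) := by
      rw [← pow_mul, ← AddChar.map_nsmul_eq_pow, nsmul_one, Nat.cast_mul, ZMod.natCast_val,
        ZMod.cast_id', id]
    simp only [q, map_add, map_pow, Polynomial.aeval_X]
    rw [key, key, mul_neg, AddChar.map_neg_eq_inv, twoCos_eq]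
  have h0 : Polynomial.aeval (stdAddChar (1 : ZMod N) : ℂ) (q a + q b - q c - q d) = 0 := by
    have := hq 1
    simp only [pow_one, Nat.cast_one, one_mul] at this
    simp only [map_add, map_sub, this]
    rw [sub_sub, sub_eq_zero]
    exact_mod_cast h
  have h1 := aeval_pow_eq_zero isPrimitiveRoot_char_one ht h0
  simp only [map_add, map_sub, hq] at h1
  rw [sub_sub, sub_eq_zero] at h1
  exact_mod_cast h1

theorem mul_eq_of_odd (hN : Odd N) {a b c d : ZMod N}
    (h : twoCos a + twoCos b = twoCos c + twoCos d) :
    twoCos a * twoCos b = twoCos c * twoCos d := by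
  have h2 := twoCos_conj (t := 2) (Nat.coprime_two_left.2 hN) h
  simp only [twoCos_two_mul] at h2
  linear_combination (1 / 2) * (twoCos a + twoCos b + (twoCos c + twoCos d)) * h - (1 / 2) * h2

theorem mul_eq_of_not_three_dvd (hN : ¬ 3 ∣ N) {a b c d : ZMod N}
    (h : twoCos a + twoCos b = twoCos c + twoCos d) (h0 : twoCos a + twoCos b ≠ 0) :
    twoCos a * twoCos b = twoCos c * twoCos d := by
  have h3 := twoCos_conj (t := 3) ((Nat.Prime.coprime_iff_not_dvd Nat.prime_three).2 hN) h
  simp only [twoCos_three_mul] at h3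
  generalize twoCos a = x at *
  generalize twoCos b = y at *
  generalize twoCos c = z at *
  generalize twoCos d = w at *
  obtain rfl : w = x + y - z := by linarith
  apply mul_left_cancel₀ h0
  linear_combination (-1 / 3) * h3

/-- A zero would make the character value a primitive fourth root of unity, which is not an `N`-th
root of unity unless `4 ∣ N`. -/
theorem twoCos_ne_zero (hN : ¬ 4 ∣ N) (k : ZMod N) : twoCos k ≠ 0 := by
  intro h
  have h1 : (stdAddChar k : ℂ) ^ 2 = -1 := by
    have := twoCos_eq k
    rw [h] at this
    have hk := char_ne_zero k
    field_simp at this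
    push_cast at this
    linear_combination -this
  have key (l : ℕ) : (stdAddChar k : ℂ) ^ l = 1 ↔ N ∣ l * k.val := by
    rw [← AddChar.map_nsmul_eq_pow, ← AddChar.map_zero_eq_one (stdAddChar (N := N)),
      ZMod.injective_stdAddChar.eq_iff, ← ZMod.natCast_eq_zero_iff, Nat.cast_mul, ZMod.natCast_val,
      ZMod.cast_id', id, nsmul_eq_mul]
  have h4 : N ∣ 4 * k.val := (key 4).1 (by linear_combination (stdAddChar k ^ 2 - 1 : ℂ) * h1)
  have h2 : ¬ N ∣ 2 * k.val := fun h => by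
    have := (key 2).2 h
    rw [h1] at this
    norm_num at this
  rcases Nat.even_or_odd' N with ⟨M, rfl | hM⟩
  · have h5 : M ∣ 2 * k.val := by
      apply Nat.dvd_of_mul_dvd_mul_left (k := 2) two_pos
      rwa [← mul_assoc]
    have hM : Nat.Coprime M 2 := by
      rw [Nat.coprime_two_right, ← Nat.not_even_iff_odd, even_iff_two_dvd]
      rintro ⟨m, rfl⟩
      exact hN ⟨m, by ring⟩
    exact h2 (mul_dvd_mul_left 2 (hM.dvd_of_dvd_mul_left h5))
  · have hc : Nat.Coprime N 4 :=
      (Nat.coprime_two_right.2 ⟨M, hM⟩).pow_right 2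
    exact h2 ((hc.dvd_of_dvd_mul_left h4).mul_left 2)

/-- Let `s` be the common sum and `p ≠ q` the two products. Dividing the conjugates for `t = 5, 7`
by `s (p - q)` leaves two symmetric equations in `p, q`, which force `pq = 0`; but no cosine
vanishes. -/
theorem mul_eq_of_not_four_dvd (h4 : ¬ 4 ∣ N) (h5 : ¬ 5 ∣ N) (h7 : ¬ 7 ∣ N) {a b c d : ZMod N}
    (h : twoCos a + twoCos b = twoCos c + twoCos d) (h0 : twoCos a + twoCos b ≠ 0) :
    twoCos a * twoCos b = twoCos c * twoCos d := by
  have e5 := twoCos_conj (t := 5) ((Nat.Prime.coprime_iff_not_dvd Nat.prime_five).2 h5) h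
  have e7 := twoCos_conj (t := 7) ((Nat.Prime.coprime_iff_not_dvd (by norm_num)).2 h7) h
  simp only [twoCos_five_mul, twoCos_seven_mul] at e5 e7
  have ha := twoCos_ne_zero h4 a
  have hb := twoCos_ne_zero h4 b
  have hc := twoCos_ne_zero h4 c
  have hd := twoCos_ne_zero h4 d
  by_contra hne
  generalize twoCos a = x at *
  generalize twoCos b = y at *
  generalize twoCos c = z at *
  generalize twoCos d = w at *
  obtain ⟨s, hs⟩ : ∃ s, s = x + y := ⟨_, rfl⟩
  obtain ⟨p, hp⟩ : ∃ p, p = x * y := ⟨_, rfl⟩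
  obtain ⟨q, hq⟩ : ∃ q, q = z * w := ⟨_, rfl⟩
  obtain rfl : y = s - x := by linarith
  obtain rfl : w = s - z := by linarith
  have hs0 : s ≠ 0 := hs ▸ h0
  have hpq : p - q ≠ 0 := by rw [hp, hq]; exact sub_ne_zero.2 hne
  have f5 : p + q = s ^ 2 - 3 := by
    apply mul_left_cancel₀ (mul_ne_zero hs0 hpq)
    subst p q
    linear_combination (1 / 5) * e5
  have f7 : p ^ 2 + p * q + q ^ 2 - 2 * s ^ 2 * (p + q) + s ^ 4 + 5 * (p + q) - 5 * s ^ 2 + 6 = 0 := by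
    apply (mul_eq_zero_iff_left (mul_ne_zero hs0 hpq)).1
    subst p q
    linear_combination (-1 / 7) * e7
  -- With `p + q = s² - 3`, the equation `f7` becomes `(-3)² + 5(-3) + 6 - pq = 0`, and the
  -- constants cancel.
  have f : p * q = 0 := by
    linear_combination -f7 + (p + q + s ^ 2 - 3 - 2 * s ^ 2 + 5) * f5
  rw [hp, hq] at f
  exact mul_ne_zero (mul_ne_zero ha hb) (mul_ne_zero hc hd) f

end TwoCos

end DiscreteTorus

namespace DiscreteTorus

open ZMod (stdAddChar)

/-! ### Diagonalization by characters -/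

section Spectrum

/-- For `N ≥ 3` the four generators are distinct and nonzero, so at most one indicator is 1. -/
theorem adj_apply {N : ℕ} (hN : 3 ≤ N) (u v : ZMod N × ZMod N) :
    adj N u v = (if v = u + (0, 1) then 1 else 0) + (if v = u + (0, -1) then 1 else 0) +
      (if v = u + (1, 0) then 1 else 0) + (if v = u + (-1, 0) then 1 else 0) := by
  classical
  have h1 : (1 : ZMod N) ≠ 0 := by
    have : Fact (1 < N) := ⟨by omega⟩
    exact one_ne_zero
  have h2 : (1 : ZMod N) ≠ -1 := by
    intro h
    have : ((2 : ℕ) : ZMod N) = 0 := by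
      push_cast
      linear_combination h
    have := Nat.le_of_dvd two_pos ((ZMod.natCast_eq_zero_iff 2 N).1 this)
    omega
  obtain ⟨w, rfl⟩ : ∃ w, v = u + w := ⟨v - u, by abel⟩
  have hadj : (torus N).Adj u (u + w) ↔
      w = (0, 1) ∨ w = (0, -1) ∨ w = (1, 0) ∨ w = (-1, 0) := by
    rw [torus, SimpleGraph.addCayley_adj']
    have (g : ZMod N × ZMod N) : (u + g = u + w ∨ u = u + w + g) ↔ (w = g ∨ w = -g) := by
      rw [add_right_inj, add_assoc, left_eq_add, eq_comm, add_eq_zero_iff_eq_neg]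
    simp only [this, genSet, Set.mem_insert_iff, Set.mem_singleton_iff, ne_eq, left_eq_add]
    constructor
    · rintro ⟨-, g, rfl | rfl | rfl | rfl, h | h⟩ <;> simp_all
    · rintro (rfl | rfl | rfl | rfl)
      · exact ⟨by simp [h1], (0, 1), by simp⟩
      · exact ⟨by simp [h1], (0, -1), by simp⟩
      · exact ⟨by simp [h1], (1, 0), by simp⟩
      · exact ⟨by simp [h1], (-1, 0), by simp⟩
  rw [adj, SimpleGraph.adjMatrix_apply]
  simp only [hadj, add_right_inj]
  have h3 : (-1 : ZMod N) ≠ 1 := h2.symm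
  by_cases w1 : w = (0, 1)
  · subst w1; simp [h1, h2]
  by_cases w2 : w = (0, -1)
  · subst w2; simp [h1, h3]
  by_cases w3 : w = (1, 0)
  · subst w3; simp [h1, h2]
  by_cases w4 : w = (-1, 0)
  · subst w4; simp [h1, h3]
  simp [w1, w2, w3, w4]

variable {N : ℕ} [NeZero N]

/-- The matrix of characters of `ℤ/N × ℤ/N`. -/
noncomputable def charMatrix (N : ℕ) [NeZero N] : Matrix (ZMod N × ZMod N) (ZMod N × ZMod N) ℂ :=
  Matrix.of fun u k => stdAddChar (u.1 * k.1 + u.2 * k.2)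

theorem charMatrix_mul :
    charMatrix N * Matrix.of (fun k v => stdAddChar (-(k.1 * v.1 + k.2 * v.2))) =
      ((N : ℂ) ^ 2) • (1 : Matrix (ZMod N × ZMod N) (ZMod N × ZMod N) ℂ) := by
  ext u v
  have h (k : ZMod N × ZMod N) :
      (stdAddChar (u.1 * k.1 + u.2 * k.2) : ℂ) * stdAddChar (-(k.1 * v.1 + k.2 * v.2)) =
        stdAddChar (k.1 * (u.1 - v.1)) * stdAddChar (k.2 * (u.2 - v.2)) := by
    rw [← AddChar.map_add_eq_mul, ← AddChar.map_add_eq_mul]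
    congr 1
    ring
  simp only [charMatrix, Matrix.mul_apply, Matrix.of_apply, h]
  rw [Fintype.sum_prod_type]
  dsimp only
  rw [← Finset.sum_mul_sum,
    AddChar.sum_mulShift _ (ZMod.isPrimitive_stdAddChar N),
    AddChar.sum_mulShift _ (ZMod.isPrimitive_stdAddChar N)]
  simp only [sub_eq_zero, ZMod.card, Matrix.smul_apply, Matrix.one_apply, Prod.ext_iff, smul_eq_mul]
  split_ifs <;> simp_all [sq]

theorem isUnit_charMatrix : IsUnit (charMatrix N) := by
  have hN : ((N : ℂ) ^ 2) ≠ 0 := pow_ne_zero 2 (Nat.cast_ne_zero.2 (NeZero.ne N))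
  rw [Matrix.isUnit_iff_isUnit_det]
  refine IsUnit.of_mul_eq_one (M := ℂ) (((N : ℂ) ^ 2)⁻¹ • Matrix.of
    (fun k v : ZMod N × ZMod N => (stdAddChar (-(k.1 * v.1 + k.2 * v.2)) : ℂ))).det ?_
  rw [← Matrix.det_mul, Matrix.mul_smul, charMatrix_mul, smul_smul, inv_mul_cancel₀ hN, one_smul,
    Matrix.det_one]

theorem adj_mul_charMatrix (hN : 3 ≤ N) :
    (adj N).map (algebraMap ℝ ℂ) * charMatrix N =
      charMatrix N * Matrix.diagonal (fun k => (mu N k.1 k.2 : ℂ)) := by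
  ext u k
  rw [Matrix.mul_diagonal, Matrix.mul_apply]
  simp only [Matrix.map_apply, adj_apply hN, map_add, apply_ite (algebraMap ℝ ℂ), map_one, map_zero,
    add_mul, ite_mul, one_mul, zero_mul, Finset.sum_add_distrib, Finset.sum_ite_eq',
    Finset.mem_univ, if_true]
  rw [mu_eq]
  push_cast
  rw [twoCos_eq, twoCos_eq]
  simp only [charMatrix, Matrix.of_apply, ← AddChar.map_neg_eq_inv, Prod.fst_add, Prod.snd_add]
  simp only [mul_add, add_mul, ← AddChar.map_add_eq_mul, neg_mul, one_mul, add_zero]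
  ring_nf

theorem charpoly_adj (hN : 3 ≤ N) :
    (adj N).charpoly =
      ∏ k : ZMod N × ZMod N, (Polynomial.X - Polynomial.C (mu N k.1 k.2)) := by
  apply Polynomial.map_injective (algebraMap ℝ ℂ) (algebraMap ℝ ℂ).injective
  obtain ⟨U, hU⟩ := isUnit_charMatrix (N := N)
  have h : (adj N).map (algebraMap ℝ ℂ) =
      U.val * Matrix.diagonal (fun k => (mu N k.1 k.2 : ℂ)) * U⁻¹.val := by
    rw [Units.eq_mul_inv_iff_mul_eq, hU, adj_mul_charMatrix hN]
  rw [← Matrix.charpoly_map, h, Matrix.coe_units_inv, Matrix.charpoly_units_conj, Matrix.charpoly_diagonal,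
    Polynomial.map_prod]
  simp

theorem mult_eq_card (hN : 3 ≤ N) (a b : ZMod N) :
    mult N a b = (Finset.univ.filter fun k : ZMod N × ZMod N => mu N k.1 k.2 = mu N a b).card := by
  have h : spec N = Finset.univ.val.map fun k : ZMod N × ZMod N => mu N k.1 k.2 := by
    rw [spec, charpoly_adj hN, ← Polynomial.roots_multiset_prod_X_sub_C (Multiset.map _ _),
      Multiset.map_map]
    rfl
  rw [mult, h, Multiset.count_map]
  simp only [eq_comm]
  rfl

end Spectrum

end DiscreteTorus

namespace DiscreteTorus

/-! ### Counting representations of an eigenvalue -/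

section Count

theorem eq_neg_iff_of_odd {N : ℕ} (hO : Odd N) (k : ZMod N) : k = -k ↔ k = 0 := by
  rw [eq_comm, ZMod.neg_eq_self_iff]
  refine or_iff_left fun h => ?_
  obtain ⟨M, hM⟩ := hO
  omega

variable {N : ℕ} [NeZero N]

/-- Equal sums and products give equal pairs up to order; the two orders give the two rectangles,
which coincide if `b = ±a` and are disjoint otherwise. -/
theorem mult_eq_card_union (hN : 3 ≤ N) {a b : ZMod N}
    (H : ∀ c d : ZMod N, twoCos c + twoCos d = twoCos a + twoCos b →
      twoCos c * twoCos d = twoCos a * twoCos b) :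
    mult N a b = (({a, -a} : Finset (ZMod N)) ×ˢ ({b, -b} : Finset (ZMod N)) ∪
      ({b, -b} : Finset (ZMod N)) ×ˢ ({a, -a} : Finset (ZMod N))).card := by
  rw [mult_eq_card hN]
  congr 1
  ext ⟨c, d⟩
  rw [Finset.mem_filter_univ]
  simp only [Finset.mem_union, Finset.mem_product, Finset.mem_insert, Finset.mem_singleton, mu_eq,
    ← twoCos_eq_iff]
  constructor
  · exact fun h => eq_pair_of_sum_mul h (H c d h)
  · rintro (⟨h1, h2⟩ | ⟨h1, h2⟩) <;> rw [h1, h2]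
    exact add_comm _ _

theorem mult_eq_sq (hN : 3 ≤ N) {a b : ZMod N} (hab : b = a ∨ b = -a)
    (H : ∀ c d : ZMod N, twoCos c + twoCos d = twoCos a + twoCos b →
      twoCos c * twoCos d = twoCos a * twoCos b) :
    mult N a b = ({a, -a} : Finset (ZMod N)).card ^ 2 := by
  have h : ({b, -b} : Finset (ZMod N)) = {a, -a} := by
    rcases hab with rfl | rfl
    · rfl
    · rw [neg_neg, Finset.pair_comm]
  rw [mult_eq_card_union hN H, h, Finset.union_self, Finset.card_product, sq]

theorem mult_eq_two_mul (hN : 3 ≤ N) {a b : ZMod N} (h1 : a ≠ b) (h2 : a ≠ -b)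
    (H : ∀ c d : ZMod N, twoCos c + twoCos d = twoCos a + twoCos b →
      twoCos c * twoCos d = twoCos a * twoCos b) :
    mult N a b =
      2 * (({a, -a} : Finset (ZMod N)).card * ({b, -b} : Finset (ZMod N)).card) := by
  have h3 : -a ≠ b := fun h => h2 (by rw [← h, neg_neg])
  rw [mult_eq_card_union hN H, Finset.card_union_of_disjoint, Finset.card_product,
    Finset.card_product]
  · ring
  · apply Finset.disjoint_product.2
    left
    have h4 : -b ≠ a := h2.symm
    simp [h1.symm, h3.symm, h4]

theorem half_add_half (hE : Even N) : half N + half N = 0 := by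
  obtain ⟨M, rfl⟩ := hE
  rw [half, ← Nat.cast_add, ZMod.natCast_eq_zero_iff, ← two_mul, ← two_mul,
    Nat.mul_div_cancel_left M two_pos]

theorem neg_half (hE : Even N) : -half N = half N :=
  neg_eq_of_add_eq_zero_left (half_add_half hE)

theorem half_ne_zero (hE : Even N) : half N ≠ 0 := by
  intro h
  rw [half, ZMod.natCast_eq_zero_iff] at h
  have h0 := NeZero.pos N
  obtain ⟨M, rfl⟩ := hE
  have := Nat.le_of_dvd (by omega) h
  omega

theorem char_half (hE : Even N) : (ZMod.stdAddChar (half N) : ℂ) = -1 := by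
  have h : (ZMod.stdAddChar (half N) : ℂ) * ZMod.stdAddChar (half N) = 1 := by
    rw [← AddChar.map_add_eq_mul, half_add_half hE, AddChar.map_zero_eq_one]
  refine (mul_self_eq_one_iff.1 h).resolve_left fun h => half_ne_zero hE ?_
  rwa [← AddChar.map_zero_eq_one (ZMod.stdAddChar (N := N)),
    ZMod.injective_stdAddChar.eq_iff] at h

theorem twoCos_add_half (hE : Even N) (k : ZMod N) : twoCos (k + half N) = -twoCos k := by
  apply Complex.ofReal_injective
  push_cast
  rw [twoCos_eq, twoCos_eq, AddChar.map_add_eq_mul, char_half hE, mul_neg_one, inv_neg]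
  ring

theorem eq_neg_iff_of_even (hE : Even N) (k : ZMod N) : k = -k ↔ k = 0 ∨ k = half N := by
  constructor
  · intro h
    have h1 : (ZMod.stdAddChar k : ℂ) * ZMod.stdAddChar k = 1 := by
      rw [← AddChar.map_add_eq_mul, eq_neg_iff_add_eq_zero.1 h, AddChar.map_zero_eq_one]
    rwa [mul_self_eq_one_iff, ← char_half hE, ← AddChar.map_zero_eq_one (ZMod.stdAddChar (N := N)),
      ZMod.injective_stdAddChar.eq_iff, ZMod.injective_stdAddChar.eq_iff] at h1
  · rintro (rfl | rfl)
    · rw [neg_zero]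
    · rw [neg_half hE]

/-- The zero set is the union of the graphs `c = d + N/2` and `c = -(d + N/2)`, each with `N`
points, which meet in exactly two. -/
theorem mult_eq_of_mu_eq_zero (hN : 3 ≤ N) (hE : Even N) {a b : ZMod N} (h : mu N a b = 0) :
    mult N a b = 2 * N - 2 := by
  have hset : (Finset.univ.filter fun k : ZMod N × ZMod N => mu N k.1 k.2 = 0) =
      Finset.univ.image (fun x : ZMod N => (x + half N, x)) ∪
        Finset.univ.image (fun x : ZMod N => (-(x + half N), x)) := by
    ext ⟨c, d⟩
    have : mu N c d = 0 ↔ c = d + half N ∨ c = -(d + half N) := by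
      rw [← twoCos_eq_iff, twoCos_add_half hE, mu_eq, add_eq_zero_iff_eq_neg]
    simp [this, eq_comm]
  have hinter : Finset.univ.image (fun x : ZMod N => (x + half N, x)) ∩
        Finset.univ.image (fun x : ZMod N => (-(x + half N), x)) =
      {(half N, 0), (0, half N)} := by
    ext ⟨c, d⟩
    simp only [Finset.mem_inter, Finset.mem_image, Finset.mem_univ, true_and, Prod.mk.injEq,
      exists_eq_right, Finset.mem_insert, Finset.mem_singleton]
    constructor
    · rintro ⟨h1, h2⟩
      have h3 : c = -c := by rw [← h1, h2, h1]
      have h4 : d = c + half N := by rw [← h1, add_assoc, half_add_half hE, add_zero]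
      rcases (eq_neg_iff_of_even hE c).1 h3 with rfl | rfl
      · exact Or.inr ⟨rfl, by rw [h4, zero_add]⟩
      · exact Or.inl ⟨rfl, by rw [h4, half_add_half hE]⟩
    · rintro (⟨rfl, rfl⟩ | ⟨rfl, rfl⟩)
      · simp [neg_half hE]
      · simp [half_add_half hE]
  have hcard := Finset.card_union_add_card_inter
    (Finset.univ.image (fun x : ZMod N => (x + half N, x)))
    (Finset.univ.image (fun x : ZMod N => (-(x + half N), x)))
  rw [hinter, ← hset, Finset.card_image_of_injective _ (fun x y h => (Prod.ext_iff.1 h).2),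
    Finset.card_image_of_injective _ (fun x y h => (Prod.ext_iff.1 h).2), Finset.card_univ,
    ZMod.card, Finset.card_pair (by simp [half_ne_zero hE])] at hcard
  rw [mult_eq_card hN, h]
  omega

end Count

end DiscreteTorus

/-! ### The multiplicities -/

theorem proposition2p3 (N : ℕ) [NeZero N] (hN : 3 ≤ N) :
    (Odd N →
      DiscreteTorus.mult N 0 0 = 1 ∧
      (∀ k : ZMod N, k ≠ 0 →
        DiscreteTorus.mult N 0 k = 4 ∧ DiscreteTorus.mult N k k = 4 ∧
          DiscreteTorus.mult N k (-k) = 4) ∧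
      (∀ k₁ k₂ : ZMod N, k₁ ≠ 0 → k₂ ≠ 0 → k₁ ≠ k₂ → k₁ ≠ -k₂ →
        DiscreteTorus.mult N k₁ k₂ = 8)) ∧
    (Even N → ¬ 12 ∣ N → ¬ 30 ∣ N → ¬ 42 ∣ N →
      DiscreteTorus.mu N 0 (DiscreteTorus.half N) = 0 ∧
      DiscreteTorus.mult N 0 (DiscreteTorus.half N) = 2 * N - 2 ∧
      (∀ k₁ k₂ : ZMod N, DiscreteTorus.mu N k₁ k₂ = 0 →
        DiscreteTorus.mult N k₁ k₂ = 2 * N - 2) ∧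
      DiscreteTorus.mult N 0 0 = 1 ∧
      DiscreteTorus.mult N (DiscreteTorus.half N) (DiscreteTorus.half N) = 1 ∧
      (∀ k : ZMod N, k ≠ 0 → k ≠ DiscreteTorus.half N →
        DiscreteTorus.mult N 0 k = 4 ∧ DiscreteTorus.mult N (DiscreteTorus.half N) k = 4 ∧
          (DiscreteTorus.mu N k k ≠ 0 →
            DiscreteTorus.mult N k k = 4 ∧ DiscreteTorus.mult N k (-k) = 4)) ∧
      (∀ k₁ k₂ : ZMod N, k₁ ≠ 0 → k₁ ≠ DiscreteTorus.half N →
        k₂ ≠ 0 → k₂ ≠ DiscreteTorus.half N → k₁ ≠ k₂ → k₁ ≠ -k₂ →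
        DiscreteTorus.mu N k₁ k₂ ≠ 0 → DiscreteTorus.mult N k₁ k₂ = 8)) := by
  open DiscreteTorus in
  have two_sq_eq : 2 ^ 2 = 4 := rfl
  have hz : ({0, -0} : Finset (ZMod N)).card = 1 := by simp
  constructor
  · intro hO
    have H (a b c d : ZMod N) (h : twoCos c + twoCos d = twoCos a + twoCos b) :=
      mul_eq_of_odd hO h
    have hk {k : ZMod N} (h : k ≠ 0) : ({k, -k} : Finset (ZMod N)).card = 2 :=
      Finset.card_pair (mt (eq_neg_iff_of_odd hO k).1 h)
    refine ⟨?_, fun k h => ⟨?_, ?_, ?_⟩, fun a b ha hb h1 h2 => ?_⟩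
    · rw [mult_eq_sq hN (Or.inl rfl) (H _ _), hz, one_pow]
    · rw [mult_eq_two_mul hN h.symm (neg_ne_zero.2 h).symm (H _ _), hz, hk h]
    · rw [mult_eq_sq hN (Or.inl rfl) (H _ _), hk h, two_sq_eq]
    · rw [mult_eq_sq hN (Or.inr rfl) (H _ _), hk h, two_sq_eq]
    · rw [mult_eq_two_mul hN h1 h2 (H _ _), hk ha, hk hb]
  · intro hE h12 h30 h42
    have H (a b : ZMod N) (h0 : mu N a b ≠ 0) (c d : ZMod N)
        (h : twoCos c + twoCos d = twoCos a + twoCos b) :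
        twoCos c * twoCos d = twoCos a * twoCos b := by
      rw [mu_eq, ← h] at h0
      -- If `6 ∣ N`, then 12, 30 and 42 not dividing `N` means that 4, 5 and 7 do not.
      by_cases h3 : 3 ∣ N
      · have h2 := even_iff_two_dvd.1 hE
        exact mul_eq_of_not_four_dvd (by omega) (by omega) (by omega) h h0
      · exact mul_eq_of_not_three_dvd h3 h h0
    have hk {k : ZMod N} (h : k ≠ 0) (h' : k ≠ half N) :
        ({k, -k} : Finset (ZMod N)).card = 2 :=
      Finset.card_pair fun e => ((eq_neg_iff_of_even hE k).1 e).elim h h'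
    have hh : ({half N, -half N} : Finset (ZMod N)).card = 1 := by simp [neg_half hE]
    have h_zero {a b : ZMod N} : mu N a b = 0 ↔ a = b + half N ∨ a = -(b + half N) := by
      rw [← twoCos_eq_iff, twoCos_add_half hE, mu_eq, add_eq_zero_iff_eq_neg]
    have h2 := half_add_half hE
    have h0 := half_ne_zero hE
    have hneg := neg_half hE
    have hmu : mu N 0 (half N) = 0 := h_zero.2 (Or.inl h2.symm)
    refine ⟨hmu, mult_eq_of_mu_eq_zero hN hE hmu, fun a b => mult_eq_of_mu_eq_zero hN hE, ?_, ?_,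
      fun k h h' => ⟨?_, ?_, fun hm => ⟨?_, ?_⟩⟩, fun a b ha ha' hb hb' h1 h2 hm => ?_⟩
    · rw [mult_eq_sq hN (Or.inl rfl) (H _ _ ?_), hz, one_pow]
      rw [Ne, h_zero]
      simpa [hneg] using h0.symm
    · rw [mult_eq_sq hN (Or.inl rfl) (H _ _ ?_), hh, one_pow]
      rw [Ne, h_zero]
      simpa [h2] using h0
    · rw [mult_eq_two_mul hN h.symm (neg_ne_zero.2 h).symm (H _ _ ?_), hz, hk h h']
      rw [Ne, h_zero, zero_eq_neg, eq_comm, or_self, add_eq_zero_iff_eq_neg, hneg]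
      exact h'
    · have h3 : half N ≠ -k := fun e => h' (by rw [← hneg, e, neg_neg])
      rw [mult_eq_two_mul hN (Ne.symm h') h3 (H _ _ ?_), hh, hk h h']
      rw [Ne, h_zero, neg_add, hneg]
      simpa using h
    · rw [mult_eq_sq hN (Or.inl rfl) (H _ _ hm), hk h h', two_sq_eq]
    · rw [mult_eq_sq hN (Or.inr rfl) (H _ _ ?_), hk h h', two_sq_eq]
      rwa [mu_eq, (twoCos_eq_iff (k := -k) (l := k)).2 (Or.inr rfl)]
    · rw [mult_eq_two_mul hN h1 h2 (H _ _ hm), hk ha ha', hk hb hb']
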